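/- Let $n\in\mathbb N$, let $H_S\in\mathbb C^{n\times n}$ be Hermitian and let $T\in(0,\infty]$. For $m\ge 1$, a Hermitian $H_B\in\mathbb C^{m\times m}$ and a unitary $U$ on $\mathbb C^n\otimes\mathbb C^m$ put $$\Phi_{T,m}(H_B,U):=\operatorname{tr}_B\Big(U\Big((\cdot)\otimes\frac{e^{-H_B/T}}{\operatorname{tr}(e^{-H_B/T})}\Big)U^*\Big)\ \text{ for } T<\infty,\qquad \Phi_{\infty,m}(H_B,U):=\operatorname{tr}_B\Big(U\Big((\cdot)\otimes\frac{\mathbb 1_m}{m}\Big)U^*\Big),$$ where $\operatorname{tr}_B$ is the partial trace over $\mathbb C^m$; these are linear maps on $\mathbb C^{n\times n}$. Let $$\mathsf{TO}(H_S,T):=\bigcup_{m\ge 1}\big\{\Phi_{T,m}(H_B,U): H_B\in\mathbb C^{m\times m}\text{ Hermitian},\ U\text{ unitary},\ U(H_S\otimes\mathbb 1+\mathbb 1\otimes H_B)U^*=H_S\otimes\mathbb 1+\mathbb 1\otimes H_B\big\}$$ be the set of thermal operations, and for real $r>0$ let $\mathsf{TO}^{r}_{\mathsf{Spin}}(H_S,T)$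 be the set of all maps $\Phi_{T,\beta_1+\ldots+\beta_m}(H_B,e^{iH_{\mathsf{tot}}})$ where $m\ge 1$, $\beta_1,\ldots,\beta_m\ge 1$ are integers, $H_B=\bigoplus_{j=1}^m jr\,\mathbb 1_{\beta_j}$, and $H_{\mathsf{tot}}$ is Hermitian on $\mathbb C^n\otimes\mathbb C^{\beta_1+\ldots+\beta_m}$ with $[H_{\mathsf{tot}},H_S\otimes\mathbb 1+\mathbb 1\otimes H_B]=0$. If $r>0$ is a real number such that the spectrum of $\operatorname{ad}_{H_S}=[H_S,\,\cdot\,]$ on $\mathbb C^{n\times n}$ satisfies $\sigma(\operatorname{ad}_{H_S})\subseteq r\mathbb Z$, then $$\overline{\mathsf{TO}(H_S,T)}=\overline{\mathsf{TO}^{r}_{\mathsf{Spin}}(H_S,T)},$$ the closures being taken in the finite-dimensional space of linear maps on $\mathbb C^{n\times n}$. -/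

import Mathlib

open scoped Kronecker Matrix ENNReal

noncomputable section

namespace ThermalOp

variable {ι κ : Type*} [Fintype ι] [DecidableEq ι] [Fintype κ] [DecidableEq κ]

/-- Partial trace over the second (bath) tensor factor. -/
def partialTraceBath : Matrix (ι × κ) (ι × κ) ℂ →ₗ[ℂ] Matrix ι ι ℂ where
  toFun X := Matrix.of fun i j => ∑ k, X (i, k) (j, k)
  map_add' X Y := by
    ext i j
    simp [Finset.sum_add_distrib]
  map_smul' c X := by
    ext i j
    simp [Finset.mul_sum]

/-- The Gibbs state `exp (-H / T) / tr (exp (-H / T))` of a Hamiltonian `H` at a finite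
temperature `T`. -/
def gibbsState (T : ℝ) (H : Matrix κ κ ℂ) : Matrix κ κ ℂ :=
  (Matrix.trace (NormedSpace.exp (-((1 / T : ℝ) : ℂ) • H)))⁻¹ •
    NormedSpace.exp (-((1 / T : ℝ) : ℂ) • H)

/-- The map `A ↦ tr_B (U (A ⊗ ω) Uᴴ)`, where `ω` is the Gibbs state of the bath Hamiltonian `HB`
at the finite temperature `T`, as a linear map on matrices. -/
def interactionLinearMap (T : ℝ) (HB : Matrix κ κ ℂ) (U : Matrix (ι × κ) (ι × κ) ℂ) :
    Matrix ι ι ℂ →ₗ[ℂ] Matrix ι ι ℂ where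
  toFun A := partialTraceBath (U * (A ⊗ₖ gibbsState T HB) * Uᴴ)
  map_add' A B := by
    rw [Matrix.add_kronecker, Matrix.mul_add, Matrix.add_mul, map_add]
  map_smul' c A := by
    rw [Matrix.smul_kronecker, Matrix.mul_smul, Matrix.smul_mul, map_smul, RingHom.id_apply]

/-- The same map as an element of the space of (automatically continuous) linear maps on the
finite-dimensional space of matrices, with the usual topology of that space. -/
def interactionMap (T : ℝ) (HB : Matrix κ κ ℂ) (U : Matrix (ι × κ) (ι × κ) ℂ) :
    Matrix ι ι ℂ →L[ℂ] Matrix ι ι ℂ :=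
  LinearMap.toContinuousLinearMap (interactionLinearMap T HB U)

/-- The map obtained from a bath `HB` at a temperature `T ∈ (0, ∞]`. At `T = ∞` the Gibbs state
is replaced by the maximally mixed state, i.e. by the Gibbs state of the identity. -/
def thermalMap (T : ℝ≥0∞) (HB : Matrix κ κ ℂ) (U : Matrix (ι × κ) (ι × κ) ℂ) :
    Matrix ι ι ℂ →L[ℂ] Matrix ι ι ℂ :=
  if T = ⊤ then interactionMap 1 1 U else interactionMap T.toReal HB U

/-- The Hamiltonian `HS ⊗ 1 + 1 ⊗ HB` of the uncoupled system and bath. -/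
def totalHamiltonian (HS : Matrix ι ι ℂ) (HB : Matrix κ κ ℂ) : Matrix (ι × κ) (ι × κ) ℂ :=
  HS ⊗ₖ (1 : Matrix κ κ ℂ) + (1 : Matrix ι ι ℂ) ⊗ₖ HB

/-- The adjoint map `ad H : A ↦ H * A - A * H` on matrices. Its spectrum is the Bohr spectrum
of `H`. -/
def adMap (H : Matrix ι ι ℂ) : Module.End ℂ (Matrix ι ι ℂ) :=
  LinearMap.mulLeft ℂ H - LinearMap.mulRight ℂ H

/-- The thermal operations with respect to the system Hamiltonian `HS` and the temperature `T`. -/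
def TO (HS : Matrix ι ι ℂ) (T : ℝ≥0∞) : Set (Matrix ι ι ℂ →L[ℂ] Matrix ι ι ℂ) :=
  {S | ∃ (m : ℕ) (HB : Matrix (Fin m) (Fin m) ℂ) (U : Matrix (ι × Fin m) (ι × Fin m) ℂ),
    0 < m ∧ HB.IsHermitian ∧ U ∈ Matrix.unitaryGroup (ι × Fin m) ℂ ∧
    U * totalHamiltonian HS HB * Uᴴ = totalHamiltonian HS HB ∧
    S = thermalMap T HB U}

/-- The spin Hamiltonian `⨁ j = 1, …, m, (j * r) 1_{β j}` with gap `r` and degeneracies `β`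
(`j` is shifted by one, as `Fin m` starts at zero). -/
def spinHamiltonian (r : ℝ) {m : ℕ} (β : Fin m → ℕ) :
    Matrix ((j : Fin m) × Fin (β j)) ((j : Fin m) × Fin (β j)) ℂ :=
  Matrix.blockDiagonal' fun j : Fin m =>
    ((((j : ℕ) + 1 : ℝ) * r : ℝ) : ℂ) • (1 : Matrix (Fin (β j)) (Fin (β j)) ℂ)

/-- The thermal operations whose bath is a spin Hamiltonian with gap `r`. -/
def TOSpin (r : ℝ) (HS : Matrix ι ι ℂ) (T : ℝ≥0∞) :
    Set (Matrix ι ι ℂ →L[ℂ] Matrix ι ι ℂ) :=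
  {S | ∃ (m : ℕ) (β : Fin m → ℕ)
      (Htot : Matrix (ι × ((j : Fin m) × Fin (β j))) (ι × ((j : Fin m) × Fin (β j))) ℂ),
    0 < m ∧ (∀ j, 0 < β j) ∧ Htot.IsHermitian ∧
    ⁅Htot, totalHamiltonian HS (spinHamiltonian r β)⁆ = 0 ∧
    S = thermalMap T (spinHamiltonian r β) (NormedSpace.exp (Complex.I • Htot))}

end ThermalOp

end

open Filter Topology

/-! Spin thermal operations are thermal operations because `exp (i H)` is a unitary commuting with
whatever `H` commutes with. For the other inclusion, diagonalize the bath, with energies `b k`, and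
cut the unitary into system blocks `B k l`. Energy conservation reads `[HS, B k l] = (b l - b k) B k
l`, so a nonzero block forces `b l - b k` into the Bohr spectrum, hence into `r ℤ`: only levels
congruent modulo `r` are coupled.

Write `b k = c k + j r` with `c` constant on each class. Dropping `c` preserves energy conservation
and leaves spin energies, but the Boltzmann weight of level `k` loses the factor `exp (-c k / T)`.
Multiplicities restore it: level `k` is replaced by `⌈L exp (-c k / T)⌉` copies. The number of
copies is constant on classes, so the interaction can act copy by copy. One uncoupled level at each
of `r, …, M r` makes every degeneracy positive, and its relative weight vanishes as `L → ∞`. The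
channels therefore converge to the given one. The key lemmas are
`IsBlockInteraction.block_eq_zero_or`, `exists_offset`, `blockMap_amplify` and `tendsto_blockMap`.
-/

open scoped Matrix.Norms.L2Operator in
/-- A unitary matrix that commutes with a Hermitian matrix `K` is `exp (i H)` for a Hermitian
matrix `H` that commutes with `K`. -/
theorem exists_isHermitian_exp_eq {n : Type*} [Fintype n] [DecidableEq n] {U K : Matrix n n ℂ}
    (hU : U ∈ Matrix.unitaryGroup n ℂ) (hK : K.IsHermitian) (h : Commute U K) :
    ∃ H : Matrix n n ℂ, H.IsHermitian ∧ Commute H K ∧ NormedSpace.exp (Complex.I • H) = U := by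
  have h₁ := Matrix.mem_unitaryGroup_iff.mp hU
  have h₂ := Matrix.mem_unitaryGroup_iff'.mp hU
  have hn : IsStarNormal U := ⟨h₂.trans h₁.symm⟩
  -- The spectrum is finite, so the jump of `Complex.arg` does not obstruct the functional calculus.
  have hf : ∀ f : ℂ → ℂ, ContinuousOn f (spectrum ℂ U) := fun f =>
    (Matrix.finite_spectrum U).continuousOn f
  refine ⟨cfc (fun z : ℂ => (Complex.arg z : ℂ)) U, ?_, ?_, ?_⟩
  · change star _ = _
    rw [← cfc_star]
    simp
  · refine Commute.cfc h ?_ _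
    have := congrArg star h.eq
    rw [star_mul, star_mul] at this
    have hs : star K = K := hK
    rw [hs] at this
    exact this.symm
  · rw [← cfc_const_mul Complex.I _ U (hf _),
      ← CFC.complex_exp_eq_normedSpace_exp (cfc_predicate _ _),
      ← cfc_comp' Complex.exp _ U Complex.continuous_exp.continuousOn (hf _)]
    conv_rhs => rw [← cfc_id ℂ U]
    refine cfc_congr fun z hz => ?_
    have hz1 : ‖z‖ = 1 := by
      have hU' : U ∈ unitary (Matrix n n ℂ) := hU
      have := spectrum.norm_eq_one_of_unitary hU' hz
      simpa using this
    have := Complex.norm_mul_exp_arg_mul_I z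
    rw [hz1, mul_comm (Complex.arg z : ℂ)] at this
    simpa using this

noncomputable section

set_option linter.unusedSectionVars false

namespace ThermalOp

variable {ι κ κ' : Type*} [Fintype ι] [DecidableEq ι] [Fintype κ] [DecidableEq κ] [Fintype κ']
  [DecidableEq κ']

/-! ### Block description of interactions with a diagonal bath -/

/-- The system matrix at the position `(k, l)` of the bath. -/
def bathBlock (U : Matrix (ι × κ) (ι × κ) ℂ) (k l : κ) : Matrix ι ι ℂ :=
  Matrix.of fun i j => U (i, k) (j, l)

/-- The matrix with prescribed blocks. -/
def ofBathBlocks (B : κ → κ → Matrix ι ι ℂ) : Matrix (ι × κ) (ι × κ) ℂ :=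
  Matrix.of fun x y => B x.2 y.2 x.1 y.1

/-- The map `A ↦ K A Kᴴ`. -/
def conjMap (K : Matrix ι ι ℂ) : Matrix ι ι ℂ →L[ℂ] Matrix ι ι ℂ :=
  LinearMap.toContinuousLinearMap (LinearMap.mulLeft ℂ K ∘ₗ LinearMap.mulRight ℂ Kᴴ)

@[simp]
theorem conjMap_apply (K A : Matrix ι ι ℂ) : conjMap K A = K * A * Kᴴ := by
  simp [conjMap, mul_assoc]

/-- The channel with Kraus operators `B k l` in which the bath level `l` has the unnormalized
weight `w l`. -/
def blockMap (w : κ → ℝ) (B : κ → κ → Matrix ι ι ℂ) : Matrix ι ι ℂ →L[ℂ] Matrix ι ι ℂ :=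
  ((∑ l, w l : ℝ) : ℂ)⁻¹ • ∑ l, (w l : ℂ) • ∑ k, conjMap (B k l)

/-- The matrices `B k l` are the blocks of a unitary that commutes with the total Hamiltonian of
the system `HS` and a diagonal bath with energies `b`. -/
structure IsBlockInteraction (HS : Matrix ι ι ℂ) (b : κ → ℝ) (B : κ → κ → Matrix ι ι ℂ) :
    Prop where
  sum_mul : ∀ k k', ∑ l, B k l * (B k' l)ᴴ = if k = k' then 1 else 0
  comm : ∀ k l, HS * B k l - B k l * HS = ((b l - b k : ℝ) : ℂ) • B k l

/-- The diagonal bath Hamiltonian with energies `b`. -/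
def bathDiagonal (b : κ → ℝ) : Matrix κ κ ℂ := Matrix.diagonal fun k => (b k : ℂ)

/-- The Boltzmann weight of the bath level `k` at the temperature `t`. -/
def boltzmann (t : ℝ) (b : κ → ℝ) (k : κ) : ℝ := Real.exp (-(1 / t) * b k)

theorem boltzmann_pos (t : ℝ) (b : κ → ℝ) (k : κ) : 0 < boltzmann t b k := Real.exp_pos _

theorem gibbsState_bathDiagonal (t : ℝ) (b : κ → ℝ) :
    gibbsState t (bathDiagonal b) = Matrix.diagonal fun k =>
      ((∑ l, boltzmann t b l : ℝ) : ℂ)⁻¹ * (boltzmann t b k : ℂ) := by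
  have h : NormedSpace.exp (-((1 / t : ℝ) : ℂ) • bathDiagonal b) =
      Matrix.diagonal fun k => (boltzmann t b k : ℂ) := by
    rw [bathDiagonal, ← Matrix.diagonal_smul, Matrix.exp_diagonal]
    congr 1
    ext k
    rw [Pi.coe_exp, ← Complex.exp_eq_exp_ℂ]
    simp [boltzmann]
  rw [gibbsState, h, ← Matrix.diagonal_smul, Matrix.trace_diagonal]
  congr 1
  ext k
  simp

/-- Since `⊤.toReal = 0` and `1 / 0 = 0`, the finite-temperature formula at `0` gives uniform
weights. This lets `T = ∞` be treated together with finite `T`. -/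
theorem gibbsState_one_one (H : Matrix κ κ ℂ) :
    gibbsState 1 (1 : Matrix κ κ ℂ) = gibbsState 0 H := by
  have h : (1 : Matrix κ κ ℂ) = bathDiagonal fun _ => 1 := by simp [bathDiagonal]
  rw [h, gibbsState_bathDiagonal]
  simp [gibbsState, boltzmann]
  ext i j
  have := Complex.exp_ne_zero (-1)
  simp only [Matrix.smul_apply, Matrix.one_apply, Matrix.diagonal_apply, smul_eq_mul, mul_ite,
    mul_one, mul_zero]
  split_ifs
  · field_simp
  · rfl

theorem thermalMap_eq (T : ℝ≥0∞) (HB : Matrix κ κ ℂ) (U : Matrix (ι × κ) (ι × κ) ℂ) :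
    thermalMap T HB U = interactionMap T.toReal HB U := by
  rw [thermalMap]
  split_ifs with h
  · subst h
    ext A : 1
    simp [interactionMap, interactionLinearMap, gibbsState_one_one HB]
  · rfl

theorem bathBlock_ofBathBlocks (B : κ → κ → Matrix ι ι ℂ) : bathBlock (ofBathBlocks B) = B := rfl

theorem ofBathBlocks_bathBlock (U : Matrix (ι × κ) (ι × κ) ℂ) :
    ofBathBlocks (bathBlock U) = U := rfl

theorem bathBlock_mul_conjTranspose (U V : Matrix (ι × κ) (ι × κ) ℂ) (k k' : κ) :
    bathBlock (U * Vᴴ) k k' = ∑ l, bathBlock U k l * (bathBlock V k' l)ᴴ := by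
  ext i j
  simp only [bathBlock, Matrix.of_apply, Matrix.mul_apply, Fintype.sum_prod_type,
    Matrix.sum_apply, Matrix.conjTranspose_apply]
  exact Finset.sum_comm

theorem bathBlock_mul_kronecker_diagonal (U : Matrix (ι × κ) (ι × κ) ℂ) (A : Matrix ι ι ℂ)
    (c : κ → ℂ) (k l : κ) :
    bathBlock (U * (A ⊗ₖ Matrix.diagonal c)) k l = c l • (bathBlock U k l * A) := by
  ext i j
  simp [bathBlock, Matrix.mul_apply, Fintype.sum_prod_type, Matrix.diagonal_apply, Finset.mul_sum]
  exact Finset.sum_congr rfl fun x _ => by ring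

theorem partialTraceBath_eq_sum (X : Matrix (ι × κ) (ι × κ) ℂ) :
    partialTraceBath X = ∑ k, bathBlock X k k := by
  ext i j
  simp [partialTraceBath, bathBlock, Matrix.sum_apply]

theorem interactionMap_bathDiagonal (t : ℝ) (b : κ → ℝ) (U : Matrix (ι × κ) (ι × κ) ℂ) :
    interactionMap t (bathDiagonal b) U = blockMap (boltzmann t b) (bathBlock U) := by
  ext A : 1
  change partialTraceBath (U * (A ⊗ₖ gibbsState t (bathDiagonal b)) * Uᴴ) = _
  simp only [gibbsState_bathDiagonal, partialTraceBath_eq_sum, bathBlock_mul_conjTranspose,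
    bathBlock_mul_kronecker_diagonal, blockMap, smul_apply, sum_apply,
    conjMap_apply, Finset.smul_sum, smul_smul, smul_mul_assoc]
  exact Finset.sum_comm

theorem bathBlock_totalHamiltonian_mul (HS : Matrix ι ι ℂ) (b : κ → ℝ)
    (U : Matrix (ι × κ) (ι × κ) ℂ) (k l : κ) :
    bathBlock (totalHamiltonian HS (bathDiagonal b) * U) k l =
      HS * bathBlock U k l + (b k : ℂ) • bathBlock U k l := by
  ext i j
  simp [bathBlock, Matrix.mul_apply, Fintype.sum_prod_type, totalHamiltonian, bathDiagonal,
    Matrix.one_apply, Matrix.diagonal_apply, add_mul, Finset.sum_add_distrib]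

theorem bathBlock_mul_totalHamiltonian (HS : Matrix ι ι ℂ) (b : κ → ℝ)
    (U : Matrix (ι × κ) (ι × κ) ℂ) (k l : κ) :
    bathBlock (U * totalHamiltonian HS (bathDiagonal b)) k l =
      bathBlock U k l * HS + (b l : ℂ) • bathBlock U k l := by
  ext i j
  simp [bathBlock, Matrix.mul_apply, Fintype.sum_prod_type, totalHamiltonian, bathDiagonal,
    Matrix.one_apply, Matrix.diagonal_apply, mul_add, Finset.sum_add_distrib]
  ring

theorem bathBlock_injective : Function.Injective (bathBlock : Matrix (ι × κ) (ι × κ) ℂ → _) :=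
  fun U V h => by
  rw [← ofBathBlocks_bathBlock U, h, ofBathBlocks_bathBlock]

theorem bathBlock_one (k l : κ) :
    bathBlock (1 : Matrix (ι × κ) (ι × κ) ℂ) k l = if k = l then 1 else 0 := by
  ext i j
  by_cases h : k = l <;> simp [bathBlock, Matrix.one_apply, h]

/-- Both conditions are compared block by block; `U * Uᴴ = 1` alone suffices for unitarity of a
square matrix. -/
theorem isBlockInteraction_bathBlock_iff (HS : Matrix ι ι ℂ) (b : κ → ℝ)
    (U : Matrix (ι × κ) (ι × κ) ℂ) :
    IsBlockInteraction HS b (bathBlock U) ↔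
      U ∈ Matrix.unitaryGroup (ι × κ) ℂ ∧ Commute U (totalHamiltonian HS (bathDiagonal b)) := by
  have h1 : U ∈ Matrix.unitaryGroup (ι × κ) ℂ ↔
      ∀ k k', ∑ l, bathBlock U k l * (bathBlock U k' l)ᴴ = if k = k' then 1 else 0 := by
    rw [Matrix.mem_unitaryGroup_iff, Matrix.star_eq_conjTranspose, ← bathBlock_injective.eq_iff]
    simp only [funext_iff, bathBlock_mul_conjTranspose, bathBlock_one]
  have h2 : Commute U (totalHamiltonian HS (bathDiagonal b)) ↔ ∀ k l,
      HS * bathBlock U k l - bathBlock U k l * HS = ((b l - b k : ℝ) : ℂ) • bathBlock U k l := by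
    rw [Commute, SemiconjBy, ← bathBlock_injective.eq_iff]
    simp only [funext_iff, bathBlock_totalHamiltonian_mul, bathBlock_mul_totalHamiltonian]
    refine forall₂_congr fun k l => ?_
    rw [Complex.ofReal_sub, sub_smul, sub_eq_sub_iff_add_eq_add, eq_comm, add_comm (_ • _)]
  rw [h1, h2]
  exact ⟨fun h => ⟨h.1, h.2⟩, fun h => ⟨h.1, h.2⟩⟩

theorem mul_mul_conjTranspose_eq_iff_commute {n : Type*} [Fintype n] [DecidableEq n]
    {U K : Matrix n n ℂ} (hU : U ∈ Matrix.unitaryGroup n ℂ) :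
    U * K * Uᴴ = K ↔ Commute U K := by
  have h₁ : U * Uᴴ = 1 := Matrix.mem_unitaryGroup_iff.mp hU
  have h₂ : Uᴴ * U = 1 := Matrix.mem_unitaryGroup_iff'.mp hU
  constructor
  · intro h
    rw [Commute, SemiconjBy]
    nth_rw 2 [← h]
    rw [mul_assoc _ Uᴴ, h₂, mul_one]
  · intro h
    rw [h.eq, mul_assoc, h₁, mul_one]

/-! ### From blocks to thermal and spin thermal operations -/

theorem IsBlockInteraction.reindex {HS : Matrix ι ι ℂ} {b : κ → ℝ}
    {B : κ → κ → Matrix ι ι ℂ} (h : IsBlockInteraction HS b B) (e : κ' ≃ κ) :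
    IsBlockInteraction HS (b ∘ e) (fun k l => B (e k) (e l)) where
  sum_mul k k' := by
    rw [e.sum_comp (fun l => B (e k) l * (B (e k') l)ᴴ), h.sum_mul]
    simp
  comm k l := h.comm _ _

theorem blockMap_reindex (w : κ → ℝ) (B : κ → κ → Matrix ι ι ℂ) (e : κ' ≃ κ) :
    blockMap (w ∘ e) (fun k l => B (e k) (e l)) = blockMap w B := by
  simp only [blockMap, Function.comp_apply]
  rw [e.sum_comp]
  congr 1
  rw [← e.sum_comp (fun l => (w l : ℂ) • ∑ k, conjMap (B k l))]
  exact Finset.sum_congr rfl fun l _ => by rw [e.sum_comp (fun k => conjMap (B k (e l)))]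

theorem bathDiagonal_isHermitian (b : κ → ℝ) : (bathDiagonal b).IsHermitian := by
  simp [bathDiagonal, Matrix.IsHermitian, Matrix.diagonal_conjTranspose, Pi.star_def]

theorem blockMap_mem_TO {HS : Matrix ι ι ℂ} {T : ℝ≥0∞} [Nonempty κ] {b : κ → ℝ}
    {B : κ → κ → Matrix ι ι ℂ} (h : IsBlockInteraction HS b B) :
    blockMap (boltzmann T.toReal b) B ∈ TO HS T := by
  let e := (Fintype.equivFin κ).symm
  have h' := h.reindex e
  rw [← bathBlock_ofBathBlocks (fun k l => B (e k) (e l)),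
    isBlockInteraction_bathBlock_iff] at h'
  refine ⟨Fintype.card κ, bathDiagonal (b ∘ e), ofBathBlocks fun k l => B (e k) (e l),
    Fintype.card_pos, bathDiagonal_isHermitian _, h'.1,
    (mul_mul_conjTranspose_eq_iff_commute h'.1).mpr h'.2, ?_⟩
  rw [thermalMap_eq, interactionMap_bathDiagonal, bathBlock_ofBathBlocks,
    ← blockMap_reindex _ B e]
  rfl

theorem spinHamiltonian_eq (r : ℝ) {m : ℕ} (β : Fin m → ℕ) :
    spinHamiltonian r β = bathDiagonal fun x => ((x.1 : ℕ) + 1 : ℝ) * r := by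
  ext ⟨i, a⟩ ⟨j, b⟩
  by_cases h : i = j
  · subst h
    simp [spinHamiltonian, bathDiagonal, Matrix.blockDiagonal'_apply, Matrix.one_apply,
      Matrix.diagonal_apply]
  · simp [spinHamiltonian, bathDiagonal, Matrix.blockDiagonal'_apply, 
      h]

theorem exp_I_smul_mem_unitaryGroup {n : Type*} [Fintype n] [DecidableEq n] {H : Matrix n n ℂ}
    (hH : H.IsHermitian) : NormedSpace.exp (Complex.I • H) ∈ Matrix.unitaryGroup n ℂ := by
  rw [Matrix.mem_unitaryGroup_iff, Matrix.star_eq_conjTranspose, ← Matrix.exp_conjTranspose,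
    Matrix.conjTranspose_smul, hH.eq, ← Matrix.exp_add_of_commute]
  · simp
  · simp [Commute, SemiconjBy]

theorem TOSpin_subset_TO (r : ℝ) (HS : Matrix ι ι ℂ) (T : ℝ≥0∞) : TOSpin r HS T ⊆ TO HS T := by
  rintro _ ⟨m, β, Htot, hm, hβ, hH, hcomm, rfl⟩
  have : Nonempty ((j : Fin m) × Fin (β j)) := ⟨⟨⟨0, hm⟩, ⟨0, hβ _⟩⟩⟩
  rw [thermalMap_eq, spinHamiltonian_eq, interactionMap_bathDiagonal]
  refine blockMap_mem_TO ((isBlockInteraction_bathBlock_iff _ _ _).mpr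
    ⟨exp_I_smul_mem_unitaryGroup hH, ?_⟩)
  rw [← spinHamiltonian_eq]
  have hc : Commute Htot (totalHamiltonian HS (spinHamiltonian r β)) :=
    commute_iff_lie_eq.mpr hcomm
  exact (hc.smul_left Complex.I).exp_left

theorem totalHamiltonian_isHermitian {HS : Matrix ι ι ℂ} (hHS : HS.IsHermitian)
    {HB : Matrix κ κ ℂ} (hHB : HB.IsHermitian) : (totalHamiltonian HS HB).IsHermitian := by
  rw [Matrix.IsHermitian, totalHamiltonian, Matrix.conjTranspose_add,
    Matrix.conjTranspose_kronecker, Matrix.conjTranspose_kronecker, hHS.eq, hHB.eq]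
  simp

/-- An energy-preserving interaction with a bath whose levels are `r, 2 r, …, M r`, all of them
occupied, induces a spin thermal operation. -/
theorem blockMap_mem_TOSpin {HS : Matrix ι ι ℂ} (hHS : HS.IsHermitian) {T : ℝ≥0∞} {r : ℝ} {M : ℕ}
    (hM : 0 < M) {f : κ → Fin M} (hf : Function.Surjective f) {B : κ → κ → Matrix ι ι ℂ}
    (h : IsBlockInteraction HS (fun k => ((f k : ℕ) + 1 : ℝ) * r) B) :
    blockMap (boltzmann T.toReal fun k => ((f k : ℕ) + 1 : ℝ) * r) B ∈ TOSpin r HS T := by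
  -- The degeneracies are the fibre sizes of `f`, and `e` sorts the bath levels by energy.
  let β : Fin M → ℕ := fun j => Fintype.card {k // f k = j}
  let e : ((j : Fin M) × Fin (β j)) ≃ κ :=
    (Equiv.sigmaCongrRight fun j => (Fintype.equivFin {k // f k = j}).symm).trans
      (Equiv.sigmaFiberEquiv f)
  have he : ∀ x, f (e x) = x.1 := fun x => ((Fintype.equivFin {k // f k = x.1}).symm x.2).2
  have hb : (fun k => ((f k : ℕ) + 1 : ℝ) * r) ∘ e = fun x => ((x.1 : ℕ) + 1 : ℝ) * r := by
    ext x
    simp [he]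
  have h' := h.reindex e
  rw [hb, ← bathBlock_ofBathBlocks (fun k l => B (e k) (e l)),
    isBlockInteraction_bathBlock_iff] at h'
  obtain ⟨H, hH, hHc, hU⟩ := exists_isHermitian_exp_eq h'.1
    (totalHamiltonian_isHermitian hHS (bathDiagonal_isHermitian _)) h'.2
  refine ⟨M, β, H, hM, fun j => Fintype.card_pos_iff.mpr ?_, hH, ?_, ?_⟩
  · obtain ⟨k, hk⟩ := hf j
    exact ⟨⟨k, hk⟩⟩
  · rw [spinHamiltonian_eq]
    exact commute_iff_lie_eq.mp hHc
  · rw [hU, spinHamiltonian_eq, thermalMap_eq, interactionMap_bathDiagonal,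
      bathBlock_ofBathBlocks, ← hb, ← blockMap_reindex _ B e]
    rfl

/-! ### Diagonalizing the bath Hamiltonian -/

theorem gibbsState_conj (t : ℝ) {V : Matrix κ κ ℂ} (hV : V ∈ Matrix.unitaryGroup κ ℂ)
    (H : Matrix κ κ ℂ) : gibbsState t (V * H * Vᴴ) = V * gibbsState t H * Vᴴ := by
  have h₁ : V * Vᴴ = 1 := Matrix.mem_unitaryGroup_iff.mp hV
  have h₂ : Vᴴ * V = 1 := Matrix.mem_unitaryGroup_iff'.mp hV
  have h : NormedSpace.exp (-((1 / t : ℝ) : ℂ) • (V * H * Vᴴ)) =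
      V * NormedSpace.exp (-((1 / t : ℝ) : ℂ) • H) * Vᴴ := by
    rw [← Matrix.inv_eq_right_inv h₁, ← Matrix.exp_conj _ _ (IsUnit.of_mul_eq_one _ h₁)]
    simp
  rw [gibbsState, h, Matrix.trace_mul_comm, ← mul_assoc, h₂, one_mul, gibbsState]
  simp

/-- The trace over the bath is cyclic for operators acting on the bath alone. -/
theorem partialTraceBath_conj {V : Matrix κ κ ℂ} (hV : V ∈ Matrix.unitaryGroup κ ℂ)
    (X : Matrix (ι × κ) (ι × κ) ℂ) :
    partialTraceBath (((1 : Matrix ι ι ℂ) ⊗ₖ V)ᴴ * X * ((1 : Matrix ι ι ℂ) ⊗ₖ V)) =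
      partialTraceBath X := by
  have h₁ : V * Vᴴ = 1 := Matrix.mem_unitaryGroup_iff.mp hV
  ext i j
  have h : ∀ a c, ∑ k, V c k * star (V a k) = if c = a then 1 else 0 := fun a c => by
    rw [← Matrix.one_apply, ← h₁, Matrix.mul_apply]
    rfl
  have h' : ∀ k, (((1 : Matrix ι ι ℂ) ⊗ₖ V)ᴴ * X * ((1 : Matrix ι ι ℂ) ⊗ₖ V)) (i, k) (j, k) =
      ∑ c, ∑ a, X (i, a) (j, c) * (V c k * star (V a k)) := fun k => by
    simp only [Matrix.mul_apply, Fintype.sum_prod_type, Matrix.conjTranspose_apply,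
      Matrix.kroneckerMap_apply, Matrix.one_apply]
    rw [Finset.sum_eq_single_of_mem j (Finset.mem_univ _)]
    · refine Finset.sum_congr rfl fun c _ => ?_
      rw [Finset.sum_eq_single_of_mem i (Finset.mem_univ _)]
      · rw [Finset.sum_mul]
        refine Finset.sum_congr rfl fun a _ => ?_
        simp
        ring
      · intro x _ hx
        simp [hx]
    · intro x _ hx
      simp [hx]
  change ∑ k, _ = ∑ k, X (i, k) (j, k)
  simp only [h']
  rw [Finset.sum_comm]
  refine Finset.sum_congr rfl fun c _ => ?_
  rw [Finset.sum_comm]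
  simp only [← Finset.mul_sum, h]
  simp

theorem interactionMap_conj (t : ℝ) {V : Matrix κ κ ℂ} (hV : V ∈ Matrix.unitaryGroup κ ℂ)
    (H : Matrix κ κ ℂ) (U : Matrix (ι × κ) (ι × κ) ℂ) :
    interactionMap t (V * H * Vᴴ) U =
      interactionMap t H (((1 : Matrix ι ι ℂ) ⊗ₖ V)ᴴ * U * ((1 : Matrix ι ι ℂ) ⊗ₖ V)) := by
  ext A : 1
  change partialTraceBath (U * (A ⊗ₖ gibbsState t (V * H * Vᴴ)) * Uᴴ) =
    partialTraceBath (_ * (A ⊗ₖ gibbsState t H) * _)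
  rw [gibbsState_conj t hV, ← partialTraceBath_conj hV]
  have h : A ⊗ₖ (V * gibbsState t H * Vᴴ) = ((1 : Matrix ι ι ℂ) ⊗ₖ V) * (A ⊗ₖ gibbsState t H) *
      ((1 : Matrix ι ι ℂ) ⊗ₖ V)ᴴ := by
    rw [Matrix.conjTranspose_kronecker, ← Matrix.mul_kronecker_mul, ← Matrix.mul_kronecker_mul]
    simp
  rw [h]
  simp only [Matrix.conjTranspose_mul, Matrix.conjTranspose_conjTranspose, mul_assoc]

/-- Every thermal operation is induced by a bath with a diagonal Hamiltonian. -/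
theorem exists_blockMap_of_mem_TO {HS : Matrix ι ι ℂ} {T : ℝ≥0∞}
    {S : Matrix ι ι ℂ →L[ℂ] Matrix ι ι ℂ}
    (hS : S ∈ TO HS T) : ∃ (m : ℕ) (b : Fin m → ℝ) (B : Fin m → Fin m → Matrix ι ι ℂ), 0 < m ∧
      IsBlockInteraction HS b B ∧ S = blockMap (boltzmann T.toReal b) B := by
  obtain ⟨m, HB, U, hm, hHB, hU, hcomm, rfl⟩ := hS
  rw [mul_mul_conjTranspose_eq_iff_commute hU] at hcomm
  obtain ⟨V, b, hV, rfl⟩ : ∃ (V : Matrix (Fin m) (Fin m) ℂ) (b : Fin m → ℝ),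
      V ∈ Matrix.unitaryGroup (Fin m) ℂ ∧ HB = V * bathDiagonal b * Vᴴ :=
    ⟨hHB.eigenvectorUnitary, hHB.eigenvalues, hHB.eigenvectorUnitary.2, by
      conv_lhs => rw [hHB.spectral_theorem]
      rw [Unitary.conjStarAlgAut_apply]
      rfl⟩
  set W : Matrix (ι × Fin m) (ι × Fin m) ℂ := (1 : Matrix ι ι ℂ) ⊗ₖ V with hW
  have h₁ : V * Vᴴ = 1 := Matrix.mem_unitaryGroup_iff.mp hV
  have h₂ : Vᴴ * V = 1 := Matrix.mem_unitaryGroup_iff'.mp hV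
  have hW₁ : W * Wᴴ = 1 := by
    rw [hW, Matrix.conjTranspose_kronecker, ← Matrix.mul_kronecker_mul, h₁]
    simp
  have hW₂ : Wᴴ * W = 1 := mul_eq_one_comm.mp hW₁
  have hWm : W ∈ Matrix.unitaryGroup (ι × Fin m) ℂ := Matrix.mem_unitaryGroup_iff.mpr hW₁
  have hWs : Wᴴ ∈ Matrix.unitaryGroup (ι × Fin m) ℂ := Unitary.star_mem hWm
  have htot : totalHamiltonian HS (V * bathDiagonal b * Vᴴ) =
      W * totalHamiltonian HS (bathDiagonal b) * Wᴴ := by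
    rw [totalHamiltonian, totalHamiltonian, mul_add, add_mul, hW, Matrix.conjTranspose_kronecker,
      ← Matrix.mul_kronecker_mul, ← Matrix.mul_kronecker_mul, ← Matrix.mul_kronecker_mul,
      ← Matrix.mul_kronecker_mul]
    simp [h₁]
  refine ⟨m, b, bathBlock (Wᴴ * U * W), hm, (isBlockInteraction_bathBlock_iff _ _ _).mpr
    ⟨mul_mem (mul_mem hWs hU) hWm, ?_⟩, ?_⟩
  · rw [htot] at hcomm
    have h := hcomm.eq
    rw [Commute, SemiconjBy]
    calc Wᴴ * U * W * totalHamiltonian HS (bathDiagonal b)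
        = Wᴴ * (U * (W * totalHamiltonian HS (bathDiagonal b) * Wᴴ)) * W := by
          simp only [mul_assoc, hW₂, mul_one]
      _ = Wᴴ * (W * totalHamiltonian HS (bathDiagonal b) * Wᴴ * U) * W := by rw [h]
      _ = (Wᴴ * W) * totalHamiltonian HS (bathDiagonal b) * (Wᴴ * U * W) := by
          simp only [mul_assoc]
      _ = _ := by rw [hW₂, one_mul]
  · rw [thermalMap_eq, interactionMap_conj _ hV, interactionMap_bathDiagonal]

/-- A nonzero block is an eigenvector of `adMap HS`, by energy conservation. -/
theorem IsBlockInteraction.block_eq_zero_or {HS : Matrix ι ι ℂ} {b : κ → ℝ}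
    {B : κ → κ → Matrix ι ι ℂ} (h : IsBlockInteraction HS b B) (k l : κ) :
    B k l = 0 ∨ ((b l - b k : ℝ) : ℂ) ∈ spectrum ℂ (adMap HS) := by
  refine or_iff_not_imp_left.mpr fun h0 => ?_
  refine (Module.End.hasEigenvalue_of_hasEigenvector (x := B k l) ⟨?_, h0⟩).mem_spectrum
  rw [Module.End.mem_eigenspace_iff, ← h.comm]
  simp [adMap]

/-! ### Copying bath levels and adding uncoupled ones -/

theorem sum_fin_ite_val_eq {M : Type*} [AddCommMonoid M] {N a : ℕ} (ha : a < N) (x : M) :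
    ∑ i : Fin N, (if (i : ℕ) = a then x else 0) = x := by
  rw [Finset.sum_eq_single_of_mem ⟨a, ha⟩ (Finset.mem_univ _)]
  · simp
  · intro i _ hi
    exact if_neg fun h => hi (Fin.ext h)

/-- The blocks of an interaction whose bath level `k` is replaced by `N k` copies. -/
def amplify (N : κ → ℕ) (B : κ → κ → Matrix ι ι ℂ) (x y : (k : κ) × Fin (N k)) : Matrix ι ι ℂ :=
  if (x.2 : ℕ) = y.2 then B x.1 y.1 else 0

/-- Coupled levels have equally many copies, so each copy meets exactly one partner with the same
index. -/
theorem IsBlockInteraction.amplify {HS : Matrix ι ι ℂ} {b : κ → ℝ} {B : κ → κ → Matrix ι ι ℂ}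
    (h : IsBlockInteraction HS b B) {N : κ → ℕ} (hN : ∀ k l, B k l ≠ 0 → N k = N l) :
    IsBlockInteraction HS (fun x : (k : κ) × Fin (N k) => b x.1) (amplify N B) where
  sum_mul := by
    rintro ⟨k, a⟩ ⟨k', a'⟩
    have h1 : ∀ l, ∑ i : Fin (N l), ThermalOp.amplify N B ⟨k, a⟩ ⟨l, i⟩ *
        (ThermalOp.amplify N B ⟨k', a'⟩ ⟨l, i⟩)ᴴ =
        if (a : ℕ) = a' then B k l * (B k' l)ᴴ else 0 := fun l => by
      by_cases h0 : B k l = 0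
      · simp [ThermalOp.amplify, h0]
      · have ha : (a : ℕ) < N l := hN k l h0 ▸ a.2
        rw [← sum_fin_ite_val_eq ha (if (a : ℕ) = a' then B k l * (B k' l)ᴴ else 0)]
        refine Finset.sum_congr rfl fun i _ => ?_
        simp only [ThermalOp.amplify]
        by_cases hi : (i : ℕ) = a
        · simp only [hi, if_true]
          by_cases haa : (a : ℕ) = a'
          · simp [haa]
          · simp [haa, Ne.symm haa]
        · simp [hi, Ne.symm hi]
    rw [Fintype.sum_sigma]
    simp only [h1]
    by_cases haa : (a : ℕ) = a'
    · simp only [haa, if_true, h.sum_mul]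
      refine if_congr ⟨?_, ?_⟩ rfl rfl
      · rintro rfl
        rw [Fin.ext haa]
      · intro hx
        exact congrArg Sigma.fst hx
    · simp only [haa, if_false, Finset.sum_const_zero]
      rw [if_neg]
      intro hx
      rw [Sigma.mk.injEq] at hx
      obtain ⟨rfl, hx⟩ := hx
      exact haa (congrArg Fin.val (eq_of_heq hx))
  comm := by
    rintro ⟨k, a⟩ ⟨l, c⟩
    simp only [ThermalOp.amplify]
    split_ifs
    · exact h.comm k l
    · simp

@[simp]
theorem conjMap_zero : conjMap (0 : Matrix ι ι ℂ) = 0 := by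
  ext A : 1
  simp

/-- All copies of a level contribute the same Kraus terms, so multiplicity acts as a weight. -/
theorem blockMap_amplify (w : κ → ℝ) {B : κ → κ → Matrix ι ι ℂ} {N : κ → ℕ}
    (hN : ∀ k l, B k l ≠ 0 → N k = N l) :
    blockMap (fun x : (k : κ) × Fin (N k) => w x.1) (amplify N B) =
      blockMap (fun k => N k * w k) B := by
  have h1 : ∀ (l : κ) (a : Fin (N l)),
      ∑ x : (k : κ) × Fin (N k), conjMap (amplify N B x ⟨l, a⟩) = ∑ k, conjMap (B k l) := by
    intro l a
    rw [Fintype.sum_sigma]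
    refine Finset.sum_congr rfl fun k _ => ?_
    by_cases h0 : B k l = 0
    · simp [amplify, h0]
    · have ha : (a : ℕ) < N k := (hN k l h0).symm ▸ a.2
      rw [← sum_fin_ite_val_eq ha (conjMap (B k l))]
      refine Finset.sum_congr rfl fun i _ => ?_
      simp only [amplify]
      split_ifs <;> simp
  rw [blockMap, blockMap, Fintype.sum_sigma, Fintype.sum_sigma]
  simp only [h1, Finset.sum_const, Finset.card_univ, Fintype.card_fin, nsmul_eq_mul,
    Complex.ofReal_mul, Complex.ofReal_natCast, mul_smul, ← Nat.cast_smul_eq_nsmul ℂ]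

/-- The blocks of an interaction that acts trivially on additional bath levels. -/
def extend (μ : Type*) [DecidableEq μ] (B : κ → κ → Matrix ι ι ℂ) : κ ⊕ μ → κ ⊕ μ → Matrix ι ι ℂ
  | .inl k, .inl l => B k l
  | .inr i, .inr j => if i = j then 1 else 0
  | _, _ => 0

theorem IsBlockInteraction.extend {HS : Matrix ι ι ℂ} {b : κ → ℝ} {B : κ → κ → Matrix ι ι ℂ}
    (h : IsBlockInteraction HS b B) (b' : κ' → ℝ) :
    IsBlockInteraction HS (Sum.elim b b') (extend κ' B) where
  sum_mul := by
    rintro (k | k) (l | l)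
    · simp [ThermalOp.extend, Fintype.sum_sum_type, h.sum_mul]
    · simp [ThermalOp.extend, Fintype.sum_sum_type]
    · simp [ThermalOp.extend, Fintype.sum_sum_type]
    · by_cases hkl : k = l <;> simp [ThermalOp.extend, Fintype.sum_sum_type, hkl, eq_comm]
  comm := by
    rintro (k | k) (l | l)
    · exact h.comm k l
    · simp [ThermalOp.extend]
    · simp [ThermalOp.extend]
    · by_cases hkl : k = l <;> simp [ThermalOp.extend, hkl]

theorem blockMap_extend_zero (w : κ → ℝ) (B : κ → κ → Matrix ι ι ℂ) :
    blockMap (Sum.elim w fun _ : κ' => 0) (extend κ' B) = blockMap w B := by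
  have h0 : ∀ X : Matrix ι ι ℂ →L[ℂ] Matrix ι ι ℂ, ((0 : ℝ) : ℂ) • X = 0 := fun X => by
    rw [Complex.ofReal_zero]
    exact zero_smul ℂ X
  simp only [blockMap, Fintype.sum_sum_type, extend, Sum.elim_inl, Sum.elim_inr, h0,
    Finset.sum_const_zero, add_zero, conjMap_zero]

/-! ### Approximation by spin baths -/

theorem blockMap_smul {c : ℝ} (hc : c ≠ 0) (w : κ → ℝ) (B : κ → κ → Matrix ι ι ℂ) :
    blockMap (fun k => c * w k) B = blockMap w B := by
  have hc' : (c : ℂ) ≠ 0 := Complex.ofReal_ne_zero.mpr hc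
  simp only [blockMap, ← Finset.mul_sum, Complex.ofReal_mul, mul_smul, ← Finset.smul_sum, mul_inv]
  rw [smul_smul, smul_smul, mul_right_comm, inv_mul_cancel₀ hc', one_mul]

theorem tendsto_blockMap {α : Type*} {F : Filter α} {u : α → κ → ℝ} {w : κ → ℝ}
    (h : ∀ k, Tendsto (fun a => u a k) F (𝓝 (w k))) (hw : ∑ k, w k ≠ 0)
    (B : κ → κ → Matrix ι ι ℂ) : Tendsto (fun a => blockMap (u a) B) F (𝓝 (blockMap w B)) := by
  have hc : ∀ {v : α → ℝ} {x : ℝ}, Tendsto v F (𝓝 x) →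
      Tendsto (fun a => (v a : ℂ)) F (𝓝 (x : ℂ)) := fun hv =>
    (Complex.continuous_ofReal.tendsto _).comp hv
  refine ((hc (tendsto_finsetSum _ fun k _ => h k)).inv₀ ?_).smul
    (tendsto_finsetSum _ fun k _ => (hc (h k)).smul_const _)
  exact_mod_cast hw

/-- Finitely many reals are, up to offsets that depend only on the class modulo `r`,
the numbers `r, 2 r, …, M r`. -/
theorem exists_offset [Nonempty κ] {r : ℝ} (hr : r ≠ 0) (b : κ → ℝ) :
    ∃ (M : ℕ) (z : κ → Fin M) (c : κ → ℝ), (∀ k, b k = c k + ((z k : ℕ) + 1 : ℝ) * r) ∧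
      ∀ k l, (∃ p : ℤ, b l - b k = r * p) → c k = c l := by
  obtain ⟨A, hA⟩ := (Set.finite_range fun k => ⌊b k / r⌋).bddBelow
  obtain ⟨D, hD⟩ := (Set.finite_range fun k => ⌊b k / r⌋).bddAbove
  have hA' : ∀ k, A ≤ ⌊b k / r⌋ := fun k => hA ⟨k, rfl⟩
  have hD' : ∀ k, ⌊b k / r⌋ ≤ D := fun k => hD ⟨k, rfl⟩
  have hz : ∀ k, (((⌊b k / r⌋ - A).toNat : ℕ) : ℝ) = (⌊b k / r⌋ - A : ℝ) := fun k => by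
    have := Int.toNat_of_nonneg (sub_nonneg.mpr (hA' k))
    exact_mod_cast congrArg (Int.cast : ℤ → ℝ) this
  -- `z k` is the floor of `b k / r` shifted by the lower bound `A`; the `- 1` in `c` cancels the `+
  -- 1` in the spin energies. The fractional part depends only on the class modulo `r`.
  refine ⟨(D - A).toNat + 1, fun k => ⟨(⌊b k / r⌋ - A).toNat, ?_⟩,
    fun k => (Int.fract (b k / r) + A - 1) * r, fun k => ?_, ?_⟩
  · have := hD' k
    omega
  · simp only [hz]
    rw [← add_mul, Int.fract]
    field_simp
    ring
  · rintro k l ⟨p, hp⟩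
    have : b l / r = b k / r + p := by
      field_simp
      linarith
    simp only [this, Int.fract_add_intCast]

theorem blockMap_mem_closure_TOSpin [Nonempty κ] {HS : Matrix ι ι ℂ} (hHS : HS.IsHermitian)
    {r : ℝ} (hr : r ≠ 0)
    (hBohr : spectrum ℂ (adMap HS) ⊆ Set.range fun k : ℤ => (r : ℂ) * (k : ℂ)) {T : ℝ≥0∞}
    {b : κ → ℝ} {B : κ → κ → Matrix ι ι ℂ} (h : IsBlockInteraction HS b B) :
    blockMap (boltzmann T.toReal b) B ∈ closure (TOSpin r HS T) := by
  obtain ⟨M, z, c, hbc, hc⟩ := exists_offset hr b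
  have hM : 0 < M := (Nat.zero_le _).trans_lt (z (Classical.arbitrary κ)).2
  have hcB : ∀ k l, B k l ≠ 0 → c k = c l := fun k l h0 => hc k l <| by
    obtain ⟨p, hp⟩ := hBohr ((h.block_eq_zero_or k l).resolve_left h0)
    refine ⟨p, ?_⟩
    dsimp only at hp
    exact_mod_cast hp.symm
  -- The summand `Fin M` holds the uncoupled levels, one per spin energy; they make `f` surjective.
  let f : κ ⊕ Fin M → Fin M := Sum.elim z id
  let e : κ ⊕ Fin M → ℝ := fun x => ((f x : ℕ) + 1 : ℝ) * r
  have hz : IsBlockInteraction HS (fun k => ((z k : ℕ) + 1 : ℝ) * r) B :=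
    ⟨h.sum_mul, fun k l => by
      rw [h.comm]
      by_cases h0 : B k l = 0
      · simp [h0]
      · rw [hbc k, hbc l, hcB k l h0, add_sub_add_left_eq_sub]⟩
  have he : IsBlockInteraction HS e (extend (Fin M) B) := by
    have := hz.extend fun j : Fin M => ((j : ℕ) + 1 : ℝ) * r
    convert this using 1
    ext (x | x) <;> rfl
  let g : κ → ℝ := boltzmann T.toReal c
  let N : ℕ → κ ⊕ Fin M → ℕ := fun L => Sum.elim (fun k => ⌈g k * L⌉₊) fun _ => 1
  have hN : ∀ L k l, extend (Fin M) B k l ≠ 0 → N L k = N L l := by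
    rintro L (k | k) (l | l) h0
    · simp only [N, g, Sum.elim_inl, boltzmann, hcB k l h0]
    · exact absurd rfl h0
    · exact absurd rfl h0
    · rfl
  have hmem : ∀ L, blockMap (fun x => N L x * boltzmann T.toReal e x) (extend (Fin M) B) ∈
      TOSpin r HS T := fun L => by
    rw [← blockMap_amplify _ (hN L)]
    exact blockMap_mem_TOSpin hHS hM (f := fun x : (k : κ ⊕ Fin M) × Fin (N L k) => f x.1)
      (fun j => ⟨⟨Sum.inr j, ⟨0, Nat.one_pos⟩⟩, rfl⟩) (he.amplify (hN L))
  -- Rescaling by `L⁻¹` does not change the channel. Then `⌈g k * L⌉ / L → g k` restores the lost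
  -- Boltzmann factor, while the uncoupled levels get weight of order `1 / L`.
  have hlim : ∀ x, Tendsto (fun L : ℕ => (L : ℝ)⁻¹ * (N L x * boltzmann T.toReal e x)) atTop
      (𝓝 (Sum.elim (boltzmann T.toReal b) (fun _ => 0) x)) := by
    rintro (k | j)
    · have h1 : boltzmann T.toReal b k = g k * boltzmann T.toReal e (Sum.inl k) := by
        simp only [boltzmann, g, ← Real.exp_add, hbc k, mul_add]
        rfl
      have h2 := ((tendsto_nat_ceil_mul_div_atTop (boltzmann_pos T.toReal c k).le).comp
        (tendsto_natCast_atTop_atTop (R := ℝ))).mul_const (boltzmann T.toReal e (Sum.inl k))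
      rw [Sum.elim_inl, h1]
      refine h2.congr fun L => ?_
      simp only [N, g, Function.comp_apply, Sum.elim_inl]
      ring
    · have h2 := (tendsto_inv_atTop_nhds_zero_nat (𝕜 := ℝ)).mul_const
        (boltzmann T.toReal e (Sum.inr j))
      simpa [N] using h2
  have hpos : 0 < ∑ k, boltzmann T.toReal b k :=
    Finset.sum_pos (fun k _ => boltzmann_pos _ _ _) Finset.univ_nonempty
  have key := tendsto_blockMap hlim (by simpa [Fintype.sum_sum_type] using hpos.ne')
    (extend (Fin M) B)
  rw [blockMap_extend_zero] at key
  refine mem_closure_of_tendsto key ?_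
  filter_upwards [eventually_gt_atTop 0] with L hL
  rw [blockMap_smul (inv_ne_zero (Nat.cast_ne_zero.mpr hL.ne'))]
  exact hmem L

end ThermalOp

end

theorem corollary2 (n : ℕ) (HS : Matrix (Fin n) (Fin n) ℂ) (hHS : HS.IsHermitian)
    (r : ℝ) (hr : 0 < r)
    (hBohr : spectrum ℂ (ThermalOp.adMap HS) ⊆ Set.range fun k : ℤ => (r : ℂ) * (k : ℂ))
    (T : ℝ≥0∞) (hT : 0 < T) :
    closure (ThermalOp.TO HS T) = closure (ThermalOp.TOSpin r HS T) := by
  refine (closure_minimal ?_ isClosed_closure).antisymm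
    (closure_mono (ThermalOp.TOSpin_subset_TO r HS T))
  intro S hS
  obtain ⟨m, b, B, hm, h, rfl⟩ := ThermalOp.exists_blockMap_of_mem_TO hS
  have : Nonempty (Fin m) := ⟨⟨0, hm⟩⟩
  exact ThermalOp.blockMap_mem_closure_TOSpin hHS hr.ne' hBohr h
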